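/- A random variable $Y$ is called Poisson-binomial if it is distributed as $X_1+\cdots+X_n$ for some $n\ge 0$ and some independent random variables $X_1,\dots,X_n$ with $\mathbb P(X_i=1)=p_i=1-\mathbb P(X_i=0)$, $p_i\in[0,1]$. For an integer-valued random variable $Y$ with $f(k)=\mathbb P(Y=k)$ let $$H_\alpha(Y)=\frac{1}{1-\alpha}\log\sum_{k\in\mathbb Z} f(k)^\alpha\quad(1<\alpha<\infty),\qquad H_\infty(Y)=-\log\sup_k f(k),\qquad \Delta_\infty(Y)=\Big(\sup_k f(k)\Big)^{-2}-1,$$ where $\log$ is the natural logarithm. **Theorem.** Let $Y$ be Poisson-binomial with variance $\sigma^2$, let $\alpha\in[2,\infty]$, and let $\alpha'$ be the conjugate exponent of $\alpha$, that is, $\alpha'=\alpha/(\alpha-1)$ for $\alpha<\infty$ and $\alpha'=1$ for $\alpha=\infty$. Then $$H_\alpha(Y)\ \ge\ \log\frac{\sqrt{6\sigma^2\alpha'}}{\int_0^{\sqrt{6\sigma^2\alpha'}}e^{-t^2/2}\,dt},$$ and in particular $$H_\alpha(Y)\ \ge\ \frac12\max\Big\{\log\big(1+2\alpha'\sigma^2\big),\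 \log\Big(\frac{12\alpha'\sigma^2}{\pi}\Big)\Big\}.$$ Moreover $\Delta_\infty(Y)\ge 2\operatorname{Var}(Y)$. (If $\sigma^2=0$, the quotient in the first bound is read as its limit $1$, and $\log 0$ as $-\infty$, so that both right-hand sides are $0$.) -/

import Mathlib

open MeasureTheory ProbabilityTheory
open scoped ENNReal

/-- The law of `X₁ + ⋯ + Xₙ`, where `X₁, …, Xₙ` are independent and `Xᵢ` takes the value `1` with
probability `p i` and the value `0` with probability `1 - p i`: the image under summation of the
product of the Bernoulli laws. -/
noncomputable def poissonBinomialMeasure {n : ℕ} (p : Fin n → unitInterval) : Measure ℤ :=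
  (Measure.pi fun i => bernoulliMeasure (1 : ℤ) 0 (p i)).map fun x => ∑ i, x i

/-- `Y` is a Poisson-binomial random variable on the measure space `(Ω, P)`: it is distributed as
a finite sum of independent, not necessarily identically distributed, Bernoulli variables. -/
def IsPoissonBinomial {Ω : Type*} [MeasurableSpace Ω] (Y : Ω → ℤ) (P : Measure Ω) : Prop :=
  ∃ (n : ℕ) (p : Fin n → unitInterval), HasLaw Y (poissonBinomialMeasure p) P

open scoped Classical in
/-- The Rényi entropy of order `α ∈ [0, ∞]` (natural logarithm) of a discrete random variable `X`
with probability mass function `f x = P (X = x)`, as an extended real number: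
`(1 - α)⁻¹ log ∑ f(x)^α` for `α ∉ {0, 1, ∞}`, and
`log #{x : f x > 0}`, `-∑ f(x) log f(x)`, `-log (sup f)` for `α = 0, 1, ∞`. -/
noncomputable def renyiEntropy {Ω 𝒳 : Type*} [MeasurableSpace Ω] (α : ℝ≥0∞) (X : Ω → 𝒳)
    (P : Measure Ω) : EReal :=
  if α = 0 then ENNReal.log ({x : 𝒳 | 0 < P (X ⁻¹' {x})}.encard : ℝ≥0∞)
  else if α = 1 then
    ((∑' x : 𝒳, ENNReal.ofReal (Real.negMulLog (P.real (X ⁻¹' {x}))) : ℝ≥0∞) : EReal)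
  else if α = ∞ then -ENNReal.log (⨆ x : 𝒳, P (X ⁻¹' {x}))
  else (((1 - α.toReal)⁻¹ : ℝ) : EReal) *
    ENNReal.log (∑' x : 𝒳, P (X ⁻¹' {x}) ^ α.toReal)

/-- `Δ_∞(X) = ‖f‖_∞⁻² - 1` for an integer-valued random variable `X` with probability mass
function `f k = P (X = k)`. -/
noncomputable def deltaInfty {Ω : Type*} [MeasurableSpace Ω] (X : Ω → ℤ) (P : Measure Ω) : ℝ :=
  ((⨆ k : ℤ, P.real (X ⁻¹' {k})) ^ 2)⁻¹ - 1

/-! The proof is Fourier-analytic. Writing `f` for the mass function, `a'` for the conjugate of `a ≥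
2` and `v` for the variance, Hausdorff–Young bounds `(∑ f ^ a) ^ (a - 1)⁻¹` by the average over the
circle of the `a'`-th power of the modulus of the characteristic function. Each Bernoulli factor
gives `‖q z + 1 - q‖ ≤ exp (-q (1 - q) (1 - Re z))`, so that average is at most the mean of `exp
(-a' v (1 - cos πu))` over `[0, 1]`.

The sharp ingredient is `integral_exp_cos_le_gaussAverage`: `1 - cos πu` may be replaced by `3u²`,
which has the same mean 1 and crosses it only once. Minus the logarithm of the resulting Gaussian
average is exactly the entropy bound; the closed forms come from elementary upper bounds on that
average.

Hausdorff–Young is proved on `ZMod N` (`ZMod.hausdorffYoung`), so the law is reduced modulo `N =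
2M`. This can only increase the power sum (`tsum_rpow_le_residueLaw`), and the circle average
becomes a Riemann sum with error at most `1 / N` (`sum_exp_cos_le`), which vanishes as `M → ∞`. For
`a = ∞`, Fourier inversion replaces Hausdorff–Young. -/

/-! ### Comparison of the cosine exponent with a Gaussian. -/

/-- The average of `u ↦ exp (-3 l u²)` over the unit interval. -/
noncomputable def gaussAverage (l : ℝ) : ℝ := ∫ u in (0 : ℝ)..1, Real.exp (-(3 * l * u ^ 2))

theorem gaussAverage_pos (l : ℝ) : 0 < gaussAverage l :=
  intervalIntegral.intervalIntegral_pos_of_pos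
    (Continuous.intervalIntegrable (by fun_prop) _ _) (fun _ => Real.exp_pos _) one_pos

/-- Concavity of sine makes `sin (πu/2) / u` decreasing, so it passes the level `√(3/2)` once.
Squared and doubled, this compares `1 - cos πu` with `3u²`. -/
theorem exists_sin_crossing : ∃ u₀ ∈ Set.Icc (0 : ℝ) 1,
    (∀ u ∈ Set.Icc 0 u₀, √(3 / 2) * u ≤ Real.sin (Real.pi / 2 * u)) ∧
    (∀ u ∈ Set.Icc u₀ 1, Real.sin (Real.pi / 2 * u) ≤ √(3 / 2) * u) := by
  have hc : √(3 / 2 : ℝ) ^ 2 = 3 / 2 := Real.sq_sqrt (by norm_num)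
  have hc0 : 0 ≤ √(3 / 2 : ℝ) := Real.sqrt_nonneg _
  set c := √(3 / 2 : ℝ)
  have hconc : ∀ u ∈ Set.Icc (0 : ℝ) 1, ∀ r ∈ Set.Icc (0 : ℝ) 1,
      r * Real.sin (Real.pi / 2 * u) ≤ Real.sin (Real.pi / 2 * (r * u)) := by
    intro u hu r hr
    have hpi := Real.pi_pos
    have h := strictConcaveOn_sin_Icc.concaveOn.2 (x := 0) (y := Real.pi / 2 * u)
      ⟨le_rfl, hpi.le⟩ ⟨mul_nonneg (by positivity) hu.1, by nlinarith [hu.2]⟩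
      (sub_nonneg.2 hr.2) hr.1 (by ring)
    simp only [smul_eq_mul, Real.sin_zero, mul_zero, zero_add] at h
    calc _ ≤ _ := h
      _ = _ := by ring_nf
  have hcont : ContinuousOn (fun u : ℝ => Real.sin (Real.pi / 2 * u) - c * u) (Set.Icc (1 / 2) 1) := by
    fun_prop
  have h1 : Real.sin (Real.pi / 2 * 1) - c * 1 ≤ 0 := by
    rw [mul_one, Real.sin_pi_div_two]; nlinarith
  have h2 : 0 ≤ Real.sin (Real.pi / 2 * (1 / 2)) - c * (1 / 2) := by
    rw [show Real.pi / 2 * (1 / 2) = Real.pi / 4 by ring, Real.sin_pi_div_four]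
    nlinarith [Real.sq_sqrt (show (0 : ℝ) ≤ 2 by norm_num), Real.sqrt_nonneg 2]
  obtain ⟨u₀, hu₀, h0⟩ := intermediate_value_Icc' (by norm_num : (1 / 2 : ℝ) ≤ 1) hcont ⟨h1, h2⟩
  have hpos : 0 < u₀ := by linarith [hu₀.1]
  simp only at h0
  refine ⟨u₀, ⟨hpos.le, hu₀.2⟩, fun u hu => ?_, fun u hu => ?_⟩
  · have h := hconc u₀ ⟨hpos.le, hu₀.2⟩ (u / u₀)
      ⟨div_nonneg hu.1 hpos.le, (div_le_one hpos).2 hu.2⟩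
    rw [div_mul_cancel₀ _ hpos.ne', show Real.sin (Real.pi / 2 * u₀) = c * u₀ by linarith] at h
    calc c * u = u / u₀ * (c * u₀) := by field_simp
      _ ≤ _ := h
  · have hu0 : 0 < u := hpos.trans_le hu.1
    have h := hconc u ⟨hu0.le, hu.2⟩ (u₀ / u) ⟨div_nonneg hpos.le hu0.le, (div_le_one hu0).2 hu.1⟩
    rw [div_mul_cancel₀ _ hu0.ne', show Real.sin (Real.pi / 2 * u₀) = c * u₀ by linarith,
      div_mul_eq_mul_div, div_le_iff₀ hu0] at h
    nlinarith

theorem integral_exp_cos_le_gaussAverage {l : ℝ} (hl : 0 ≤ l) :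
    ∫ u in (0 : ℝ)..1, Real.exp (-(l * (1 - Real.cos (Real.pi * u)))) ≤ gaussAverage l := by
  obtain ⟨u₀, hu₀, hle, hge⟩ := exists_sin_crossing
  have hc : √(3 / 2 : ℝ) ^ 2 = 3 / 2 := Real.sq_sqrt (by norm_num)
  have hc0 : 0 ≤ √(3 / 2 : ℝ) := Real.sqrt_nonneg _
  have hX : ∀ u : ℝ, 1 - Real.cos (Real.pi * u) = 2 * Real.sin (Real.pi / 2 * u) ^ 2 := by
    intro u
    rw [show Real.pi * u = 2 * (Real.pi / 2 * u) by ring, Real.cos_two_mul']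
    linarith [Real.sin_sq_add_cos_sq (Real.pi / 2 * u)]
  set X : ℝ → ℝ := fun u => 1 - Real.cos (Real.pi * u) with hXdef
  have hsin : ∀ u ∈ Set.Icc (0 : ℝ) 1, 0 ≤ Real.sin (Real.pi / 2 * u) := fun u hu =>
    Real.sin_nonneg_of_nonneg_of_le_pi (mul_nonneg (by positivity) hu.1)
      (by nlinarith [hu.2, Real.pi_pos])
  have hmono : ∀ u ∈ Set.Icc (0 : ℝ) 1, ∀ v ∈ Set.Icc (0 : ℝ) 1, u ≤ v → X u ≤ X v := by
    intro u hu v hv huv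
    have := Real.cos_le_cos_of_nonneg_of_le_pi (mul_nonneg Real.pi_pos.le hu.1)
      (by nlinarith [hv.2, Real.pi_pos] : Real.pi * v ≤ Real.pi)
      (mul_le_mul_of_nonneg_left huv Real.pi_pos.le)
    simp only [hXdef]; linarith
  -- The tangent-line bound for `exp` has weight `exp (-(l * X u))` on the difference `3u² - X u`.
  -- The weight decreases and the difference changes sign at `u₀`, so the weight may be frozen at
  -- `u₀`; the correction then integrates to zero.
  have key : ∀ u ∈ Set.Icc (0 : ℝ) 1, Real.exp (-(l * X u)) +
      (-(l * Real.exp (-(l * X u₀)))) * (3 * u ^ 2 - X u) ≤ Real.exp (-(3 * l * u ^ 2)) := by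
    intro u hu
    have htan : Real.exp (-(l * X u)) * (1 + (-(l * (3 * u ^ 2 - X u)))) ≤
        Real.exp (-(3 * l * u ^ 2)) := by
      have h := Real.add_one_le_exp (-(l * (3 * u ^ 2 - X u)))
      calc _ ≤ Real.exp (-(l * X u)) * Real.exp (-(l * (3 * u ^ 2 - X u))) :=
            mul_le_mul_of_nonneg_left (by linarith) (Real.exp_pos _).le
        _ = _ := by rw [← Real.exp_add]; ring_nf
    have hcross : 0 ≤ (Real.exp (-(l * X u₀)) - Real.exp (-(l * X u))) * (3 * u ^ 2 - X u) := by
      rcases le_total u u₀ with h | h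
      · refine mul_nonneg_of_nonpos_of_nonpos ?_ ?_
        · have := mul_le_mul_of_nonneg_left (hmono u hu u₀ hu₀ h) hl
          exact sub_nonpos.2 (Real.exp_le_exp.2 (by linarith))
        · have := pow_le_pow_left₀ (mul_nonneg hc0 hu.1) (hle u ⟨hu.1, h⟩) 2
          rw [mul_pow, hc] at this
          simp only [hXdef]; rw [hX]; linarith
      · refine mul_nonneg ?_ ?_
        · have := mul_le_mul_of_nonneg_left (hmono u₀ hu₀ u hu h) hl
          exact sub_nonneg.2 (Real.exp_le_exp.2 (by linarith))
        · have := pow_le_pow_left₀ (hsin u hu) (hge u ⟨h, hu.2⟩) 2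
          rw [mul_pow, hc] at this
          simp only [hXdef]; rw [hX]; linarith
    nlinarith [mul_nonneg hl hcross]
  have hzero : ∫ u in (0 : ℝ)..1, (3 * u ^ 2 - X u) = 0 := by
    have : ∀ u ∈ Set.uIcc (0 : ℝ) 1,
        HasDerivAt (fun u => u ^ 3 - u + Real.sin (Real.pi * u) / Real.pi) (3 * u ^ 2 - X u) u := by
      intro u _
      have h1 := ((hasDerivAt_pow 3 u).sub (hasDerivAt_id u)).add
        ((((hasDerivAt_id u).const_mul Real.pi).sin).div_const Real.pi)
      refine h1.congr_deriv ?_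
      simp only [hXdef, id]
      field_simp
      push_cast
      ring
    rw [intervalIntegral.integral_eq_sub_of_hasDerivAt this
      (Continuous.intervalIntegrable (by fun_prop) _ _)]
    simp
  have hint := intervalIntegral.integral_mono_on (μ := volume) zero_le_one
    (Continuous.intervalIntegrable (by fun_prop) _ _)
    (Continuous.intervalIntegrable (by fun_prop) _ _) key
  rw [intervalIntegral.integral_add (Continuous.intervalIntegrable (by fun_prop) _ _)
    (Continuous.intervalIntegrable (by fun_prop) _ _), intervalIntegral.integral_const_mul, hzero,
    mul_zero, add_zero] at hint
  exact hint

/-! ### Closed forms and bounds for the Gaussian average. -/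

theorem integral_exp_neg_sq_half (x : ℝ) (l : ℝ) (hx : x ^ 2 = 6 * l) :
    ∫ t in (0 : ℝ)..x, Real.exp (-t ^ 2 / 2) = x * gaussAverage l := by
  have h := intervalIntegral.smul_integral_comp_mul_left (a := 0) (b := 1)
    (fun t : ℝ => Real.exp (-t ^ 2 / 2)) x
  rw [mul_zero, mul_one] at h
  rw [← h, smul_eq_mul, gaussAverage]
  congr 2
  funext u
  rw [mul_pow, hx]
  ring_nf

theorem log_sqrt_div_integral {l : ℝ} (hl : 0 ≤ l) :
    Real.log (√(6 * l) / ∫ t in (0 : ℝ)..√(6 * l), Real.exp (-t ^ 2 / 2)) =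
      -Real.log (gaussAverage l) := by
  rw [integral_exp_neg_sq_half _ l (Real.sq_sqrt (by positivity))]
  rcases hl.eq_or_lt with rfl | hl
  -- At `l = 0` the quotient is `0 / 0 = 0` and `Real.log 0 = 0`, which agrees with the intended
  -- limit `log 1`.
  · simp [gaussAverage]
  · have : √(6 * l) ≠ 0 := (Real.sqrt_pos.2 (by positivity)).ne'
    rw [div_mul_eq_div_div, div_self this, Real.log_div one_ne_zero (gaussAverage_pos l).ne',
      Real.log_one, zero_sub]

/-- The right side has derivative `(1 + t²/3) ^ (-3/2)`, which dominates `exp (-t²/2)` because `1 +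
s ≤ exp s` at `s = t²/3`. -/
theorem integral_exp_neg_sq_half_le {x : ℝ} (hx : 0 ≤ x) :
    ∫ t in (0 : ℝ)..x, Real.exp (-t ^ 2 / 2) ≤ x / √(1 + x ^ 2 / 3) := by
  have hpos : ∀ t : ℝ, 0 < 1 + t ^ 2 / 3 := fun t => by positivity
  have hd : ∀ t ∈ Set.uIcc (0 : ℝ) x, HasDerivAt (fun t => t / √(1 + t ^ 2 / 3))
      (1 / (√(1 + t ^ 2 / 3)) ^ 3) t := by
    intro t _
    have hs := Real.sqrt_pos.2 (hpos t)
    have hsq := Real.sq_sqrt (hpos t).le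
    have h1 := (((hasDerivAt_pow 2 t).div_const 3).const_add 1).sqrt (hpos t).ne'
    refine ((hasDerivAt_id t).div h1 hs.ne').congr_deriv ?_
    simp only [id]
    generalize √(1 + t ^ 2 / 3) = s at *
    field_simp
    push_cast
    nlinarith
  have hci : IntervalIntegrable (fun t : ℝ => 1 / (√(1 + t ^ 2 / 3)) ^ 3) volume 0 x := by
    refine Continuous.intervalIntegrable ?_ _ _
    refine continuous_const.div (by fun_prop) fun t => ?_
    have := Real.sqrt_pos.2 (hpos t)
    positivity
  have h := intervalIntegral.integral_eq_sub_of_hasDerivAt hd hci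
  rw [zero_div, sub_zero] at h
  rw [← h]
  refine intervalIntegral.integral_mono_on hx (Continuous.intervalIntegrable (by fun_prop) _ _) hci
    fun t _ => ?_
  have hs := Real.sqrt_pos.2 (hpos t)
  have hle : √(1 + t ^ 2 / 3) ≤ Real.exp (t ^ 2 / 6) := by
    rw [Real.sqrt_le_left (Real.exp_pos _).le, ← Real.exp_nat_mul]
    have := Real.add_one_le_exp (t ^ 2 / 3)
    calc 1 + t ^ 2 / 3 ≤ Real.exp (t ^ 2 / 3) := by linarith
      _ = _ := by congr 1; push_cast; ring
  rw [show -t ^ 2 / 2 = -((3 : ℕ) * (t ^ 2 / 6)) by push_cast; ring, Real.exp_neg,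
    Real.exp_nat_mul, one_div]
  gcongr

theorem gaussAverage_le_inv_sqrt {l : ℝ} (hl : 0 ≤ l) : gaussAverage l ≤ (√(1 + 2 * l))⁻¹ := by
  rcases hl.eq_or_lt with rfl | hl
  · simp [gaussAverage]
  have hs := Real.sqrt_pos.2 (by positivity : 0 < 6 * l)
  have hsq := Real.sq_sqrt (by positivity : 0 ≤ 6 * l)
  have h := integral_exp_neg_sq_half_le hs.le
  rw [integral_exp_neg_sq_half _ l hsq, hsq, div_eq_mul_inv,
    show 1 + 6 * l / 3 = 1 + 2 * l by ring] at h
  exact le_of_mul_le_mul_left h hs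

theorem gaussAverage_le_sqrt_pi {l : ℝ} (hl : 0 < l) :
    gaussAverage l ≤ √(Real.pi / (12 * l)) := by
  have h := integral_gaussian_Ioi (3 * l)
  rw [gaussAverage, intervalIntegral.integral_of_le zero_le_one]
  calc ∫ u in Set.Ioc (0 : ℝ) 1, Real.exp (-(3 * l * u ^ 2))
      ≤ ∫ u in Set.Ioi (0 : ℝ), Real.exp (-(3 * l) * u ^ 2) := by
        simp_rw [show ∀ u : ℝ, -(3 * l * u ^ 2) = -(3 * l) * u ^ 2 from fun u => by ring]
        exact setIntegral_mono_set (integrable_exp_neg_mul_sq (by positivity)).integrableOn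
          (Filter.Eventually.of_forall fun _ => (Real.exp_pos _).le)
          Set.Ioc_subset_Ioi_self.eventuallyLE
    _ = √(Real.pi / (12 * l)) := by
        rw [h, div_eq_iff two_ne_zero, ← Real.sqrt_sq (show (0 : ℝ) ≤ 2 by norm_num),
          ← Real.sqrt_mul (by have := Real.pi_pos; positivity)]
        congr 1
        field_simp
        norm_num

/-! ### Riemann sums over the roots of unity. -/

/-- The even order puts the antipode on the grid: reflection `j ↦ 2M - j` turns the sum into two
sums of a function decreasing on `[0, M]`, one over right endpoints and one over left endpoints. The
`+ 1` is the value at `0`, which only the left-endpoint sum contains. -/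
theorem sum_exp_cos_le {l : ℝ} (hl : 0 ≤ l) {M : ℕ} (hM : M ≠ 0) :
    ∑ j ∈ Finset.range (2 * M),
        Real.exp (-(l * (1 - Real.cos (2 * Real.pi * j / (2 * M : ℕ))))) ≤
      2 * M * gaussAverage l + 1 := by
  have hM' : (M : ℝ) ≠ 0 := by exact_mod_cast hM
  have hMpos : (0 : ℝ) < M := by positivity
  set φ : ℝ → ℝ := fun x => Real.exp (-(l * (1 - Real.cos (Real.pi * (x / M))))) with hφ
  have hanti : AntitoneOn φ (Set.Icc (0 : ℝ) (0 + M)) := by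
    intro x hx y hy hxy
    have h2 : y / M ≤ 1 := (div_le_one hMpos).2 (by linarith [hy.2])
    have := Real.cos_le_cos_of_nonneg_of_le_pi (x := Real.pi * (x / M)) (y := Real.pi * (y / M))
      (mul_nonneg Real.pi_pos.le (div_nonneg hx.1 hMpos.le))
      (by nlinarith [Real.pi_pos]) (by have := Real.pi_pos; gcongr)
    simp only [hφ]
    gcongr
  have hint := hanti.sum_le_integral
  have hsub : ∫ x in (0 : ℝ)..0 + M, φ x ≤ M * gaussAverage l := by
    have h := intervalIntegral.integral_comp_div (a := 0) (b := M)
      (fun u : ℝ => Real.exp (-(l * (1 - Real.cos (Real.pi * u))))) hM'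
    rw [zero_div, div_self hM', smul_eq_mul] at h
    rw [zero_add]
    simp only [hφ]
    rw [h]
    exact mul_le_mul_of_nonneg_left (integral_exp_cos_le_gaussAverage hl) hMpos.le
  simp only [zero_add] at hint hsub
  have hsplit : ∑ j ∈ Finset.range (2 * M),
        Real.exp (-(l * (1 - Real.cos (2 * Real.pi * j / (2 * M : ℕ))))) =
      ∑ j ∈ Finset.range M, φ j + ∑ j ∈ Finset.range M, φ ((j + 1 : ℕ) : ℝ) := by
    rw [two_mul, Finset.sum_range_add]
    congr 1
    · refine Finset.sum_congr rfl fun j _ => ?_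
      simp only [hφ]
      congr 4
      push_cast
      field_simp
      ring_nf
    · rw [← Finset.sum_range_reflect (fun j => φ ((j + 1 : ℕ) : ℝ))]
      refine Finset.sum_congr rfl fun j hj => ?_
      have hj' := Finset.mem_range.1 hj
      simp only [hφ]
      congr 4
      rw [← Real.cos_two_pi_sub, show M - 1 - j + 1 = M - j by omega, Nat.cast_sub hj'.le]
      congr 1
      push_cast
      field_simp
      ring
  have hshift : ∑ j ∈ Finset.range M, φ j ≤ ∑ j ∈ Finset.range M, φ ((j + 1 : ℕ) : ℝ) + 1 := by
    have h1 := Finset.sum_range_succ (fun j : ℕ => φ j) M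
    have h2 := Finset.sum_range_succ' (fun j : ℕ => φ j) M
    have h3 : 0 ≤ φ M := (Real.exp_pos _).le
    have h4 : φ ((0 : ℕ) : ℝ) = 1 := by simp [hφ]
    linarith
  rw [hsplit]
  linarith

/-! ### Interpolation by the three lines theorem. -/

open Complex.HadamardThreeLines in
/-- Riesz–Thorin interpolation between `ℓ¹` and `ℓ²` for a bilinear form in finite dimension. -/
theorem norm_bilin_le_of_interpolation {ι κ : Type*} [Fintype ι] [Fintype κ]
    (m : ι → κ → ℂ) (C₁ C₂ : ℝ)
    (h₁ : ∀ (x : ι → ℂ) (y : κ → ℂ),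
      ‖∑ i, ∑ j, m i j * x i * y j‖ ≤ C₁ * ((∑ i, ‖x i‖) * ∑ j, ‖y j‖))
    (h₂ : ∀ (x : ι → ℂ) (y : κ → ℂ),
      ‖∑ i, ∑ j, m i j * x i * y j‖ ≤ C₂ * √((∑ i, ‖x i‖ ^ 2) * ∑ j, ‖y j‖ ^ 2))
    (hC₁ : 0 ≤ C₁) (hC₂ : 0 ≤ C₂) {p t : ℝ} (ht : t ∈ Set.Icc (0 : ℝ) 1) (hp : p * (1 - t / 2) = 1)
    (x : ι → ℂ) (y : κ → ℂ) :
    ‖∑ i, ∑ j, m i j * x i * y j‖ ≤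
      C₁ ^ (1 - t) * C₂ ^ t * ((∑ i, ‖x i‖ ^ p) * ∑ j, ‖y j‖ ^ p) ^ p⁻¹ := by
  have hp0 : 0 < p := by
    have : 0 < 1 - t / 2 := by linarith [ht.2]
    exact pos_of_mul_pos_left (by rw [hp]; exact one_pos) this.le
  -- The analytic family `E a z` keeps the phase of `a` and has modulus `‖a‖ ^ p` on `Re z = 0`,
  -- `‖a‖ ^ (p / 2)` on `Re z = 1`, matching `ℓ¹` and `ℓ²`; at `z = t` it returns `a`.
  set w : ℂ → ℂ := fun z => p * (1 - z / 2) with hw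
  set E : ℂ → ℂ → ℂ := fun a z => a / ‖a‖ * Complex.exp (Real.log ‖a‖ * w z) with hE
  have hwre : ∀ z : ℂ, (w z).re = p * (1 - z.re / 2) := by
    intro z
    simp only [hw]
    rw [Complex.re_ofReal_mul]
    simp
  have hEnorm : ∀ a z, 0 < (w z).re → ‖E a z‖ = ‖a‖ ^ (w z).re := by
    intro a z hz
    rcases eq_or_ne a 0 with rfl | ha
    · simp [hE, Real.zero_rpow hz.ne']
    · have ha' : 0 < ‖a‖ := norm_pos_iff.2 ha
      simp only [hE, norm_mul, norm_div, Complex.norm_real, norm_norm, div_self ha'.ne', one_mul,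
        Complex.norm_exp, Complex.re_ofReal_mul]
      rw [Real.rpow_def_of_pos ha']
  have hEdiff : ∀ a, Differentiable ℂ (E a) := by
    intro a
    simp only [hE, hw]
    fun_prop
  have hEt : ∀ a, E a t = a := by
    intro a
    rcases eq_or_ne a 0 with rfl | ha
    · simp [hE]
    · have ha' : 0 < ‖a‖ := norm_pos_iff.2 ha
      have hwt : w t = 1 := by
        simp only [hw]
        exact_mod_cast hp
      simp only [hE, hwt, mul_one]
      rw [← Complex.ofReal_exp, Real.exp_log ha']
      exact div_mul_cancel₀ _ (by exact_mod_cast ha'.ne')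
  set Φ : ℂ → ℂ := fun z => ∑ i, ∑ j, m i j * E (x i) z * E (y j) z with hΦ
  have hΦdiff : Differentiable ℂ Φ := by
    simp only [hΦ]
    fun_prop
  set A := ∑ i, ‖x i‖ ^ p
  set B := ∑ j, ‖y j‖ ^ p
  have hA : 0 ≤ A := Finset.sum_nonneg fun _ _ => by positivity
  have hB : 0 ≤ B := Finset.sum_nonneg fun _ _ => by positivity
  have hbd : BddAbove ((norm ∘ Φ) '' verticalClosedStrip 0 1) := by
    refine ⟨∑ i, ∑ j, ‖m i j‖ * (1 + ‖x i‖) ^ p * (1 + ‖y j‖) ^ p, ?_⟩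
    rintro _ ⟨z, hz, rfl⟩
    have hz' : z.re ∈ Set.Icc (0 : ℝ) 1 := hz
    have hwz : 0 < (w z).re := by rw [hwre]; exact mul_pos hp0 (by linarith [hz'.2])
    have hwp : (w z).re ≤ p := by rw [hwre]; nlinarith [hz'.1]
    have hEle : ∀ a, ‖E a z‖ ≤ (1 + ‖a‖) ^ p := fun a => by
      rw [hEnorm a z hwz]
      calc ‖a‖ ^ (w z).re ≤ (1 + ‖a‖) ^ (w z).re :=
            Real.rpow_le_rpow (norm_nonneg _) (by linarith) hwz.le
        _ ≤ _ := Real.rpow_le_rpow_of_exponent_le (by linarith [norm_nonneg a]) hwp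
    refine (norm_sum_le _ _).trans (Finset.sum_le_sum fun i _ => (norm_sum_le _ _).trans
      (Finset.sum_le_sum fun j _ => ?_))
    rw [norm_mul, norm_mul]
    gcongr
    · exact hEle _
    · exact hEle _
  have hl : ∀ z ∈ Complex.re ⁻¹' {(0 : ℝ)}, ‖Φ z‖ ≤ C₁ * (A * B) := by
    intro z hz
    have hwz : (w z).re = p := by rw [hwre, show z.re = 0 from hz]; ring
    refine (h₁ _ _).trans_eq ?_
    simp_rw [hEnorm _ z (hwz ▸ hp0), hwz]
    rfl
  have hr : ∀ z ∈ Complex.re ⁻¹' {(1 : ℝ)}, ‖Φ z‖ ≤ C₂ * √(A * B) := by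
    intro z hz
    have hwz : (w z).re = p / 2 := by rw [hwre, show z.re = 1 from hz]; ring
    refine (h₂ _ _).trans_eq ?_
    have hsq : ∀ a : ℂ, (‖a‖ ^ (p / 2)) ^ 2 = ‖a‖ ^ p := fun a => by
      rw [← Real.rpow_mul_natCast (norm_nonneg a)]
      congr 1
      push_cast
      ring
    simp_rw [hEnorm _ z (hwz ▸ half_pos hp0), hwz, hsq]
    rfl
  have hmain := norm_le_interp_of_mem_verticalClosedStrip' (f := Φ) (z := t) one_pos
    (show (t : ℂ).re ∈ Set.Icc (0 : ℝ) 1 by simpa using ht) hΦdiff.diffContOnCl hbd hl hr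
  simp only [hΦ, hEt, Complex.ofReal_re, sub_zero, div_one] at hmain
  refine hmain.trans_eq ?_
  rw [Real.mul_rpow hC₁ (by positivity), Real.mul_rpow hC₂ (by positivity), Real.sqrt_eq_rpow,
    ← Real.rpow_mul (by positivity)]
  have hpinv : p⁻¹ = (1 - t) + 1 / 2 * t := by
    rw [inv_eq_iff_eq_inv, eq_comm, inv_eq_iff_eq_inv, eq_comm]
    refine (eq_inv_of_mul_eq_one_left ?_).symm
    linarith
  rw [hpinv, Real.rpow_add_of_nonneg (by positivity) (by linarith [ht.2]) (by linarith [ht.1])]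
  ring

/-! ### Fourier analysis on `ZMod N`. -/

theorem ZMod.conj_stdAddChar {N : ℕ} [NeZero N] (j : ZMod N) :
    (starRingEnd ℂ) (ZMod.stdAddChar j) = ZMod.stdAddChar (-j) := by
  rw [ZMod.stdAddChar_apply, ZMod.stdAddChar_apply, AddChar.map_neg_eq_inv, Circle.coe_inv_eq_conj]

theorem ZMod.norm_stdAddChar {N : ℕ} [NeZero N] (j : ZMod N) : ‖ZMod.stdAddChar j‖ = 1 := by
  rw [ZMod.stdAddChar_apply, Circle.norm_coe]

/-- Parseval's identity for the discrete Fourier transform. -/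
theorem ZMod.sum_norm_sq_dft {N : ℕ} [NeZero N] (Φ : ZMod N → ℂ) :
    ∑ k, ‖ZMod.dft Φ k‖ ^ 2 = N * ∑ j, ‖Φ j‖ ^ 2 := by
  have hsq : ∀ z : ℂ, ((‖z‖ ^ 2 : ℝ) : ℂ) = (starRingEnd ℂ) z * z := fun z => by
    rw [← Complex.normSq_eq_norm_sq, Complex.normSq_eq_conj_mul_self]
  apply Complex.ofReal_injective
  rw [Complex.ofReal_mul, Complex.ofReal_sum, Complex.ofReal_sum]
  simp_rw [hsq]
  calc ∑ k, (starRingEnd ℂ) (ZMod.dft Φ k) * ZMod.dft Φ k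
      = ∑ k, ∑ j, (starRingEnd ℂ) (Φ j) * (ZMod.stdAddChar (j * k) * ZMod.dft Φ k) := by
        refine Finset.sum_congr rfl fun k _ => ?_
        conv_lhs => rw [ZMod.dft_apply Φ k, map_sum, Finset.sum_mul]
        refine Finset.sum_congr rfl fun j _ => ?_
        rw [smul_eq_mul, map_mul, ZMod.conj_stdAddChar, neg_neg, ← ZMod.dft_apply]
        ring
    _ = ∑ j, (starRingEnd ℂ) (Φ j) * ZMod.dft (ZMod.dft Φ) (-j) := by
        rw [Finset.sum_comm]
        refine Finset.sum_congr rfl fun j _ => ?_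
        rw [← Finset.mul_sum, ZMod.dft_apply (ZMod.dft Φ)]
        congr 1
        refine Finset.sum_congr rfl fun k _ => ?_
        rw [smul_eq_mul]
        ring_nf
    _ = _ := by
        rw [ZMod.dft_dft, Finset.mul_sum]
        refine Finset.sum_congr rfl fun j _ => ?_
        simp only [neg_neg, smul_eq_mul]
        push_cast
        ring

/-- Fourier inversion on `ZMod N`, tested against a function. -/
theorem ZMod.sum_dft_mul {N : ℕ} [NeZero N] (F y : ZMod N → ℂ) :
    ∑ j, ∑ k, ((N : ℂ)⁻¹ * ZMod.stdAddChar (j * k)) * ZMod.dft F j * y k = ∑ k, F k * y k := by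
  rw [Finset.sum_comm]
  refine Finset.sum_congr rfl fun k _ => ?_
  have h : (N : ℂ)⁻¹ * ∑ j, ZMod.stdAddChar (j * k) * ZMod.dft F j = F k := by
    have h1 := ZMod.invDFT_apply (ZMod.dft F) k
    rw [LinearEquiv.symm_apply_apply] at h1
    simpa only [smul_eq_mul] using h1.symm
  rw [← Finset.sum_mul, ← h, Finset.mul_sum]
  simp_rw [mul_assoc]

/-- The Hausdorff–Young inequality on `ZMod N` for a nonnegative function. -/
theorem ZMod.hausdorffYoung {N : ℕ} [NeZero N] (F : ZMod N → ℝ) (hF : ∀ k, 0 ≤ F k)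
    {a : ℝ} (ha : 2 ≤ a) :
    (∑ k, F k ^ a) ^ (a - 1)⁻¹ ≤
      (N : ℝ)⁻¹ * ∑ j, ‖ZMod.dft (fun k => (F k : ℂ)) j‖ ^ (1 + (a - 1)⁻¹) := by
  have ha1 : 0 < a - 1 := by linarith
  have hN : (0 : ℝ) < N := by exact_mod_cast NeZero.pos N
  set S := ∑ k, F k ^ a with hS
  set p := 1 + (a - 1)⁻¹ with hp
  have hp0 : 0 < p := by positivity
  have hpa : (a - 1) * p = a := by rw [hp]; field_simp; ring
  have hS0 : 0 ≤ S := Finset.sum_nonneg fun k _ => Real.rpow_nonneg (hF k) _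
  rcases hS0.eq_or_lt with h0 | hSpos
  · rw [← h0, Real.zero_rpow (inv_ne_zero ha1.ne')]
    positivity
  set G := ∑ j, ‖ZMod.dft (fun k => (F k : ℂ)) j‖ ^ p with hG
  have hG0 : 0 ≤ G := by positivity
  have hm : ∀ j k : ZMod N, ‖(N : ℂ)⁻¹ * ZMod.stdAddChar (j * k)‖ = (N : ℝ)⁻¹ := fun j k => by
    rw [norm_mul, ZMod.norm_stdAddChar, mul_one, norm_inv, Complex.norm_natCast]
  -- The choice `t = 2 / a` makes `p` the conjugate exponent of `a`. The `ℓ²` constant `N ^ (-1/2)`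
  -- comes from Parseval and Cauchy–Schwarz.
  have h := norm_bilin_le_of_interpolation (p := p) (t := 2 / a)
    (fun j k : ZMod N => (N : ℂ)⁻¹ * ZMod.stdAddChar (j * k)) (N : ℝ)⁻¹ ((N : ℝ)⁻¹ ^ (1 / 2 : ℝ))
    (fun x y => by
      refine (norm_sum_le _ _).trans ?_
      rw [Finset.sum_mul_sum, Finset.mul_sum]
      refine Finset.sum_le_sum fun i _ => (norm_sum_le _ _).trans ?_
      rw [Finset.mul_sum]
      refine Finset.sum_le_sum fun j _ => ?_
      rw [norm_mul, norm_mul, hm, mul_assoc])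
    (fun x y => by
      have hrw : ∑ i, ∑ j, (N : ℂ)⁻¹ * ZMod.stdAddChar (i * j) * x i * y j =
          (N : ℂ)⁻¹ * ∑ i, x i * ZMod.dft y (-i) := by
        rw [Finset.mul_sum]
        refine Finset.sum_congr rfl fun i _ => ?_
        rw [ZMod.dft_apply, Finset.mul_sum, Finset.mul_sum]
        refine Finset.sum_congr rfl fun j _ => ?_
        rw [smul_eq_mul, mul_neg, neg_neg, mul_comm j i]
        ring
      have hcs : ‖∑ i, x i * ZMod.dft y (-i)‖ ≤
          √(∑ i, ‖x i‖ ^ 2) * √(N * ∑ j, ‖y j‖ ^ 2) := by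
        have h2 : ∑ i, ‖ZMod.dft y (-i)‖ ^ 2 = N * ∑ j, ‖y j‖ ^ 2 := by
          rw [← ZMod.sum_norm_sq_dft]
          exact Equiv.sum_comp (Equiv.neg (ZMod N)) fun i => ‖ZMod.dft y i‖ ^ 2
        rw [← h2]
        refine (norm_sum_le _ _).trans ?_
        simp_rw [norm_mul]
        exact Real.sum_mul_le_sqrt_mul_sqrt _ _ _
      rw [hrw, norm_mul, norm_inv, Complex.norm_natCast]
      refine (mul_le_mul_of_nonneg_left hcs (by positivity)).trans_eq ?_
      rw [← Real.sqrt_eq_rpow, Real.sqrt_mul (by positivity), Real.sqrt_mul (by positivity),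
        Real.sqrt_inv]
      have hs := Real.sqrt_pos.2 hN
      have hs2 := Real.mul_self_sqrt hN.le
      have : (N : ℝ)⁻¹ * √N = (√N)⁻¹ := by
        refine eq_inv_of_mul_eq_one_left ?_
        rw [mul_assoc, hs2, inv_mul_cancel₀ hN.ne']
      rw [← this]
      ring)
    (by positivity) (by positivity)
    ⟨by positivity, (div_le_one (by linarith)).2 ha⟩
    (by rw [hp]; field_simp; ring)
    -- Testing against the dual extremiser `F ^ (a - 1)` makes the form equal to `S`, and `(a - 1) p
    -- = a` makes the second norm sum equal to `S` too, so one factor `S` cancels.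
    (ZMod.dft fun k => (F k : ℂ)) (fun k => ((F k ^ (a - 1) : ℝ) : ℂ))
  have hlhs : ‖∑ k, (F k : ℂ) * ((F k ^ (a - 1) : ℝ) : ℂ)‖ = S := by
    refine Eq.trans ?_ ((Complex.norm_real S).trans (Real.norm_of_nonneg hS0))
    rw [hS, Complex.ofReal_sum]
    congr 1
    refine Finset.sum_congr rfl fun k _ => ?_
    rw [← Complex.ofReal_mul]
    congr 1
    conv_lhs => rw [← Real.rpow_one (F k), ← Real.rpow_mul (hF k), one_mul]
    rw [← Real.rpow_add_of_nonneg (hF k) zero_le_one ha1.le]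
    ring_nf
  have hnorm : ∀ k, ‖((F k ^ (a - 1) : ℝ) : ℂ)‖ ^ p = F k ^ a := fun k => by
    rw [Complex.norm_real, Real.norm_of_nonneg (Real.rpow_nonneg (hF k) _),
      ← Real.rpow_mul (hF k), hpa]
  rw [ZMod.sum_dft_mul, hlhs] at h
  simp_rw [hnorm] at h
  change S ≤ _ * (G * S) ^ p⁻¹ at h
  clear_value S G p
  have hpinv : 1 - 2 / a + 1 / 2 * (2 / a) = p⁻¹ := by
    refine eq_inv_of_mul_eq_one_left ?_
    rw [hp]
    field_simp
    ring
  have hN' : (0 : ℝ) < (N : ℝ)⁻¹ := inv_pos.2 hN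
  rw [← Real.rpow_mul hN'.le, ← Real.rpow_add hN', hpinv,
    ← Real.mul_rpow hN'.le (mul_nonneg hG0 hS0), Real.le_rpow_inv_iff_of_pos hS0
      (mul_nonneg hN'.le (mul_nonneg hG0 hS0)) hp0] at h
  rw [hp, Real.rpow_add hSpos, Real.rpow_one, mul_comm S, ← mul_assoc] at h
  exact le_of_mul_le_mul_right h hSpos

theorem ZMod.le_sum_norm_dft {N : ℕ} [NeZero N] (F : ZMod N → ℝ) (k : ZMod N) :
    F k ≤ (N : ℝ)⁻¹ * ∑ j, ‖ZMod.dft (fun k => (F k : ℂ)) j‖ := by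
  have h := ZMod.invDFT_apply (ZMod.dft fun k => (F k : ℂ)) k
  rw [LinearEquiv.symm_apply_apply] at h
  calc F k ≤ ‖(F k : ℂ)‖ := by rw [Complex.norm_real]; exact le_abs_self _
    _ ≤ _ := by
      rw [h, norm_smul, norm_inv, Complex.norm_natCast]
      refine mul_le_mul_of_nonneg_left ((norm_sum_le _ _).trans_eq ?_) (by positivity)
      simp_rw [norm_smul, ZMod.norm_stdAddChar, one_mul]

/-! ### Variance and characteristic function of the law. -/

instance {n : ℕ} (p : Fin n → unitInterval) : IsProbabilityMeasure (poissonBinomialMeasure p) :=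
  Measure.isProbabilityMeasure_map (by fun_prop)

theorem variance_bernoulliMeasure (p : unitInterval) :
    Var[fun k : ℤ => (k : ℝ); bernoulliMeasure (1 : ℤ) 0 p] = p * (1 - p) := by
  rw [variance_eq_integral (by fun_prop), integral_bernoulliMeasure, integral_bernoulliMeasure]
  simp only [smul_eq_mul]
  push_cast
  ring

theorem variance_poissonBinomialMeasure {n : ℕ} (p : Fin n → unitInterval) :
    Var[fun k : ℤ => (k : ℝ); poissonBinomialMeasure p] = ∑ i, (p i : ℝ) * (1 - p i) := by
  rw [poissonBinomialMeasure, variance_map (by fun_prop) (by fun_prop)]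
  have h := variance_sum_pi (μ := fun i => bernoulliMeasure (1 : ℤ) 0 (p i))
    (X := fun _ k => (k : ℝ))
    (fun i => (memLp_two_iff_integrable_sq (by fun_prop)).2 (integrable_bernoulliMeasure _ _ _ _))
  simp_rw [variance_bernoulliMeasure] at h
  rw [← h]
  congr 1
  ext x
  simp

theorem integral_addChar_poissonBinomialMeasure {n : ℕ} (p : Fin n → unitInterval)
    (χ : AddChar ℤ ℂ) :
    ∫ k, χ k ∂(poissonBinomialMeasure p) = ∏ i, ((p i : ℂ) * χ 1 + (1 - p i)) := by
  rw [poissonBinomialMeasure, integral_map (by fun_prop)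
    (Measurable.of_discrete).aestronglyMeasurable]
  have hsum : ∀ x : Fin n → ℤ, χ (∑ i, x i) = ∏ i, χ (x i) := fun x =>
    map_prod χ.toMonoidHom (fun i => Multiplicative.ofAdd (x i)) Finset.univ
  simp_rw [hsum]
  rw [integral_fintype_prod_eq_prod fun _ k => χ k]
  refine Finset.prod_congr rfl fun i _ => ?_
  rw [integral_bernoulliMeasure]
  simp

/-- On the unit circle the squared modulus is exactly `1 - 2 q (1 - q) (1 - Re z)`; then `1 - x ≤
exp (-x)`. -/
theorem norm_mul_add_one_sub_le {z : ℂ} (hz : ‖z‖ = 1) {q : ℝ} :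
    ‖(q : ℂ) * z + (1 - q)‖ ≤ Real.exp (-(q * (1 - q) * (1 - z.re))) := by
  have h1 : z.re * z.re + z.im * z.im = 1 := by
    rw [← Complex.normSq_apply, Complex.normSq_eq_norm_sq, hz, one_pow]
  have h2 : ‖(q : ℂ) * z + (1 - q)‖ ^ 2 = 1 - 2 * (q * (1 - q) * (1 - z.re)) := by
    rw [← Complex.normSq_eq_norm_sq, Complex.normSq_apply]
    simp
    linear_combination q ^ 2 * h1
  refine le_of_sq_le_sq ?_ (Real.exp_pos _).le
  rw [h2, ← Real.exp_nat_mul]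
  have := Real.add_one_le_exp (-(2 * (q * (1 - q) * (1 - z.re))))
  push_cast
  rw [mul_neg]
  linarith

theorem norm_integral_addChar_le {n : ℕ} (p : Fin n → unitInterval)
    (χ : AddChar ℤ ℂ) (hχ : ‖χ 1‖ = 1) :
    ‖∫ k, χ k ∂(poissonBinomialMeasure p)‖ ≤
      Real.exp (-(Var[fun k : ℤ => (k : ℝ); poissonBinomialMeasure p] * (1 - (χ 1).re))) := by
  rw [integral_addChar_poissonBinomialMeasure, variance_poissonBinomialMeasure, norm_prod,
    Finset.sum_mul, ← Finset.sum_neg_distrib, Real.exp_sum]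
  refine Finset.prod_le_prod (fun _ _ => norm_nonneg _) fun i _ => ?_
  exact norm_mul_add_one_sub_le hχ

theorem ZMod.stdAddChar_re {N : ℕ} [NeZero N] (j : ZMod N) :
    (ZMod.stdAddChar j).re = Real.cos (2 * Real.pi * j.val / N) := by
  have h := ZMod.stdAddChar_coe (N := N) (j.val : ℤ)
  rw [Int.cast_natCast, ZMod.natCast_zmod_val] at h
  rw [h, ← Complex.exp_ofReal_mul_I_re]
  congr 2
  push_cast
  ring

/-! ### Reduction modulo `N` and passage to the limit. -/

/-- The probability mass function of the residue modulo `N` of a random integer with law `μ`. -/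
noncomputable def residueLaw (μ : Measure ℤ) (N : ℕ) (r : ZMod N) : ℝ :=
  (μ.map (Int.cast : ℤ → ZMod N)).real {r}

theorem norm_dft_residueLaw_le {n : ℕ} (p : Fin n → unitInterval) {N : ℕ} [NeZero N]
    (j : ZMod N) :
    ‖ZMod.dft (fun r => (residueLaw (poissonBinomialMeasure p) N r : ℂ)) j‖ ≤
      Real.exp (-(Var[fun k : ℤ => (k : ℝ); poissonBinomialMeasure p] *
        (1 - Real.cos (2 * Real.pi * j.val / N)))) := by
  set χ : AddChar ℤ ℂ :=
    (ZMod.stdAddChar (N := N)).compAddMonoidHom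
      ((AddMonoidHom.mulRight (-j)).comp (Int.castAddHom (ZMod N))) with hχ
  have hχk : ∀ k : ℤ, χ k = ZMod.stdAddChar ((k : ZMod N) * -j) := fun k => rfl
  have hχ1 : χ 1 = (starRingEnd ℂ) (ZMod.stdAddChar j) := by
    rw [hχk, Int.cast_one, one_mul, ZMod.conj_stdAddChar]
  have h := norm_integral_addChar_le p χ (ZMod.norm_stdAddChar _)
  rw [hχ1, Complex.conj_re, ZMod.stdAddChar_re] at h
  convert h using 2
  rw [ZMod.dft_apply]
  have hm := integral_map (μ := poissonBinomialMeasure p) (φ := (Int.cast : ℤ → ZMod N))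
    (Measurable.of_discrete).aemeasurable
    (f := fun r => ZMod.stdAddChar (r * -j)) (Measurable.of_discrete).aestronglyMeasurable
  simp_rw [hχk]
  have : IsProbabilityMeasure ((poissonBinomialMeasure p).map (Int.cast : ℤ → ZMod N)) :=
    Measure.isProbabilityMeasure_map (Measurable.of_discrete).aemeasurable
  rw [← hm, integral_fintype (Integrable.of_finite)]
  refine Finset.sum_congr rfl fun r _ => ?_
  rw [smul_eq_mul, mul_neg, mul_comm, Complex.real_smul, residueLaw]

theorem measure_singleton_le_residueLaw (μ : Measure ℤ) [IsProbabilityMeasure μ] (N : ℕ) (k : ℤ) :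
    μ {k} ≤ ENNReal.ofReal (residueLaw μ N k) := by
  have : IsProbabilityMeasure (μ.map (Int.cast : ℤ → ZMod N)) :=
    Measure.isProbabilityMeasure_map (Measurable.of_discrete).aemeasurable
  rw [residueLaw, ofReal_measureReal, Measure.map_apply Measurable.of_discrete (by measurability)]
  exact measure_mono (by simp)

/-- In `f ^ a = f ^ (a - 1) * f`, only the first factor is enlarged to the residue mass; being
constant on residue classes, it lets the remaining `f` sum to the class mass. -/
theorem tsum_rpow_le_residueLaw (μ : Measure ℤ) [IsProbabilityMeasure μ] (N : ℕ) [NeZero N]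
    {a : ℝ} (ha : 1 ≤ a) :
    ∑' k, μ {k} ^ a ≤ ENNReal.ofReal (∑ r, residueLaw μ N r ^ a) := by
  have : IsProbabilityMeasure (μ.map (Int.cast : ℤ → ZMod N)) :=
    Measure.isProbabilityMeasure_map (Measurable.of_discrete).aemeasurable
  have ha' : 0 ≤ a - 1 := by linarith
  have hsplit : ∀ x : ℝ≥0∞, x ^ a = x ^ (a - 1) * x := fun x => by
    conv_rhs => rw [← ENNReal.rpow_one x, ← ENNReal.rpow_mul, one_mul]
    rw [← ENNReal.rpow_add_of_nonneg _ _ ha' zero_le_one, sub_add_cancel]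
  have hF : ∀ r, 0 ≤ residueLaw μ N r := fun r => measureReal_nonneg
  set h : ZMod N → ℝ≥0∞ := fun r => ENNReal.ofReal (residueLaw μ N r) ^ (a - 1) with hh
  calc ∑' k, μ {k} ^ a ≤ ∑' k : ℤ, h k * μ {k} := by
        refine ENNReal.tsum_le_tsum fun k => ?_
        rw [hsplit]
        refine mul_le_mul_left (ENNReal.rpow_le_rpow ?_ ha') _
        exact measure_singleton_le_residueLaw μ N k
    _ = ∫⁻ r, h r ∂(μ.map (Int.cast : ℤ → ZMod N)) := by
        rw [lintegral_map Measurable.of_discrete Measurable.of_discrete, lintegral_countable']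
    _ = _ := by
        rw [lintegral_fintype, ENNReal.ofReal_sum_of_nonneg fun r _ => Real.rpow_nonneg (hF r) _]
        refine Finset.sum_congr rfl fun r _ => ?_
        rw [← ENNReal.ofReal_rpow_of_nonneg (hF r) (by linarith), hsplit, hh]
        congr 1
        rw [residueLaw, ofReal_measureReal]

theorem ZMod.sum_val {N : ℕ} [NeZero N] (f : ℕ → ℝ) :
    ∑ j : ZMod N, f j.val = ∑ j ∈ Finset.range N, f j :=
  Finset.sum_bij (fun j _ => j.val) (fun j _ => Finset.mem_range.2 j.val_lt)
    (fun _ _ _ _ h => ZMod.val_injective N h)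
    (fun k hk => ⟨(k : ZMod N), Finset.mem_univ _, ZMod.val_cast_of_lt (Finset.mem_range.1 hk)⟩)
    (fun _ _ => rfl)

theorem average_norm_dft_residueLaw_le {n : ℕ} (p : Fin n → unitInterval) {M : ℕ} [NeZero M]
    {q : ℝ} (hq : 0 ≤ q) :
    ((2 * M : ℕ) : ℝ)⁻¹ * ∑ j : ZMod (2 * M),
        ‖ZMod.dft (fun r => (residueLaw (poissonBinomialMeasure p) (2 * M) r : ℂ)) j‖ ^ q ≤
      gaussAverage (q * Var[fun k : ℤ => (k : ℝ); poissonBinomialMeasure p]) +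
        ((2 * M : ℕ) : ℝ)⁻¹ := by
  set v := Var[fun k : ℤ => (k : ℝ); poissonBinomialMeasure p]
  have hM : (0 : ℝ) < (2 * M : ℕ) := by exact_mod_cast NeZero.pos (2 * M)
  have hv : 0 ≤ q * v := mul_nonneg hq (variance_nonneg _ _)
  have h : ∑ j : ZMod (2 * M),
      ‖ZMod.dft (fun r => (residueLaw (poissonBinomialMeasure p) (2 * M) r : ℂ)) j‖ ^ q ≤
      2 * M * gaussAverage (q * v) + 1 := by
    refine le_trans ?_ (sum_exp_cos_le hv (NeZero.ne M))
    rw [← ZMod.sum_val fun j =>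
      Real.exp (-(q * v * (1 - Real.cos (2 * Real.pi * j / (2 * M : ℕ)))))]
    refine Finset.sum_le_sum fun j _ => ?_
    refine (Real.rpow_le_rpow (norm_nonneg _) (norm_dft_residueLaw_le p j) hq).trans_eq ?_
    rw [← Real.exp_mul]
    congr 1
    ring
  rw [inv_mul_le_iff₀ hM, mul_add, mul_inv_cancel₀ hM.ne']
  exact_mod_cast h

theorem le_of_forall_le_add_inv {x y : ℝ}
    (h : ∀ M : ℕ, M ≠ 0 → x ≤ y + ((2 * M : ℕ) : ℝ)⁻¹) : x ≤ y := by
  refine le_of_forall_pos_le_add fun ε hε => ?_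
  obtain ⟨m, hm⟩ := exists_nat_one_div_lt hε
  refine (h (m + 1) m.succ_ne_zero).trans (add_le_add_right ?_ y)
  refine le_trans ?_ hm.le
  rw [one_div]
  gcongr
  push_cast
  linarith

theorem tsum_poissonBinomialMeasure_rpow_le {n : ℕ} (p : Fin n → unitInterval)
    {a : ℝ} (ha : 2 ≤ a) :
    (∑' k, poissonBinomialMeasure p {k} ^ a) ^ (a - 1)⁻¹ ≤
      ENNReal.ofReal (gaussAverage ((1 + (a - 1)⁻¹) *
        Var[fun k : ℤ => (k : ℝ); poissonBinomialMeasure p])) := by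
  set μ := poissonBinomialMeasure p
  have ha' : 0 ≤ (a - 1)⁻¹ := inv_nonneg.2 (by linarith)
  have hF : ∀ N r, 0 ≤ residueLaw μ N r := fun _ _ => measureReal_nonneg
  have hbound : ∀ M : ℕ, M ≠ 0 → (∑' k, μ {k} ^ a) ^ (a - 1)⁻¹ ≤
      ENNReal.ofReal (gaussAverage ((1 + (a - 1)⁻¹) * Var[fun k : ℤ => (k : ℝ); μ]) +
        ((2 * M : ℕ) : ℝ)⁻¹) := by
    intro M hM
    have : NeZero M := ⟨hM⟩
    refine (ENNReal.rpow_le_rpow (tsum_rpow_le_residueLaw μ (2 * M) (by linarith)) ha').trans ?_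
    rw [ENNReal.ofReal_rpow_of_nonneg
      (Finset.sum_nonneg fun r _ => Real.rpow_nonneg (hF _ r) _) ha']
    refine ENNReal.ofReal_le_ofReal ((ZMod.hausdorffYoung _ (hF _) ha).trans ?_)
    exact average_norm_dft_residueLaw_le p (by linarith)
  -- Finiteness, from the bound at `M = 1`, allows the limit to be taken in the reals.
  have hfin : (∑' k, μ {k} ^ a) ^ (a - 1)⁻¹ ≠ ∞ :=
    ne_top_of_le_ne_top ENNReal.ofReal_ne_top (hbound 1 one_ne_zero)
  rw [ENNReal.le_ofReal_iff_toReal_le hfin (gaussAverage_pos _).le]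
  refine le_of_forall_le_add_inv fun M hM => ?_
  rw [← ENNReal.le_ofReal_iff_toReal_le hfin
    (add_nonneg (gaussAverage_pos _).le (by positivity))]
  exact hbound M hM

theorem poissonBinomialMeasure_singleton_le {n : ℕ} (p : Fin n → unitInterval) (k : ℤ) :
    (poissonBinomialMeasure p).real {k} ≤
      gaussAverage (Var[fun k : ℤ => (k : ℝ); poissonBinomialMeasure p]) := by
  refine le_of_forall_le_add_inv fun M hM => ?_
  have : NeZero M := ⟨hM⟩
  have h := average_norm_dft_residueLaw_le p (M := M) zero_le_one
  simp_rw [Real.rpow_one, one_mul] at h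
  refine le_trans ?_ ((ZMod.le_sum_norm_dft _ (k : ZMod (2 * M))).trans h)
  exact ENNReal.toReal_le_of_le_ofReal measureReal_nonneg
    (measure_singleton_le_residueLaw _ (2 * M) k)

/-! ### Entropy bounds and the inequality for `deltaInfty`. -/

theorem renyiEntropy_ge {Ω : Type*} [MeasurableSpace Ω] {P : Measure Ω} [IsProbabilityMeasure P]
    {Y : Ω → ℤ} {n : ℕ} {p : Fin n → unitInterval} (hY : HasLaw Y (poissonBinomialMeasure p) P)
    {α : ℝ≥0∞} (hα : 2 ≤ α) :
    ((-Real.log (gaussAverage ((ENNReal.conjExponent α).toReal *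
      Var[fun k : ℤ => (k : ℝ); poissonBinomialMeasure p])) : ℝ) : EReal) ≤
      renyiEntropy α Y P := by
  have hpre : ∀ k : ℤ, P (Y ⁻¹' {k}) = poissonBinomialMeasure p {k} := fun k =>
    hY.measure_eq (p := fun y => y = k) .of_discrete
  have h0 : α ≠ 0 := by rintro rfl; simp at hα
  have h1 : α ≠ 1 := by rintro rfl; norm_num at hα
  have hlog : ∀ l : ℝ, ENNReal.log (ENNReal.ofReal (gaussAverage l)) =
      (Real.log (gaussAverage l) : ℝ) := fun l => ENNReal.log_ofReal_of_pos (gaussAverage_pos l)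
  rw [renyiEntropy, if_neg h0, if_neg h1]
  simp_rw [hpre]
  split_ifs with h
  · subst h
    rw [ENNReal.conjExponent, ENNReal.top_sub ENNReal.one_ne_top, ENNReal.inv_top, add_zero, ENNReal.toReal_one,
      one_mul, EReal.coe_neg, ← hlog]
    refine EReal.neg_le_neg_iff.2 (ENNReal.log_le_log (iSup_le fun k => ?_))
    rw [← ofReal_measureReal]
    exact ENNReal.ofReal_le_ofReal (poissonBinomialMeasure_singleton_le p k)
  · have ha : 2 ≤ α.toReal := by
      simpa using (ENNReal.toReal_le_toReal (by simp) h).2 hα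
    have hconj : (ENNReal.conjExponent α).toReal = 1 + (α.toReal - 1)⁻¹ := by
      have hsub : (α - 1).toReal = α.toReal - 1 := by
        rw [ENNReal.toReal_sub_of_le (one_le_two.trans hα) h, ENNReal.toReal_one]
      rw [ENNReal.conjExponent, ENNReal.toReal_add ENNReal.one_ne_top, ENNReal.toReal_one,
        ENNReal.toReal_inv, hsub]
      rw [ne_eq, ENNReal.inv_eq_top]
      intro h'
      rw [h', ENNReal.toReal_zero] at hsub
      linarith
    have hmain := ENNReal.log_le_log (tsum_poissonBinomialMeasure_rpow_le p ha)
    rw [ENNReal.log_rpow, hlog, ← hconj] at hmain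
    rw [← neg_sub α.toReal 1, inv_neg, EReal.coe_neg, EReal.coe_neg, EReal.neg_mul]
    exact EReal.neg_le_neg_iff.2 hmain

theorem half_max_log_le {l : ℝ} (hl : 0 ≤ l) :
    (1 / 2 : ℝ) * max (Real.log (1 + 2 * l)) (Real.log (12 * l / Real.pi)) ≤
      -Real.log (gaussAverage l) := by
  have h1 : Real.log (1 + 2 * l) / 2 ≤ -Real.log (gaussAverage l) := by
    have h := Real.log_le_log (gaussAverage_pos l) (gaussAverage_le_inv_sqrt hl)
    rw [Real.log_inv, Real.log_sqrt (by positivity)] at h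
    linarith
  have h2 : Real.log (12 * l / Real.pi) / 2 ≤ -Real.log (gaussAverage l) := by
    rcases hl.eq_or_lt with rfl | hl
    -- Here `Real.log 0 = 0` replaces `-∞`; the maximum is unaffected, since its other entry is `log
    -- 1 = 0`.
    · simp [gaussAverage]
    have h := Real.log_le_log (gaussAverage_pos l) (gaussAverage_le_sqrt_pi hl)
    rw [Real.log_sqrt (div_nonneg Real.pi_pos.le (by positivity)),
      ← inv_div (12 * l), Real.log_inv] at h
    linarith
  rcases max_choice (Real.log (1 + 2 * l)) (Real.log (12 * l / Real.pi)) with h | h <;>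
    rw [h] <;> linarith

theorem two_mul_variance_le_deltaInfty {Ω : Type*} [MeasurableSpace Ω] {P : Measure Ω}
    [IsProbabilityMeasure P] {Y : Ω → ℤ} {n : ℕ} {p : Fin n → unitInterval}
    (hY : HasLaw Y (poissonBinomialMeasure p) P) :
    2 * Var[fun k : ℤ => (k : ℝ); poissonBinomialMeasure p] ≤ deltaInfty Y P := by
  set v := Var[fun k : ℤ => (k : ℝ); poissonBinomialMeasure p]
  have hv : 0 ≤ v := variance_nonneg _ _
  have hpre : ∀ k : ℤ, P.real (Y ⁻¹' {k}) = (poissonBinomialMeasure p).real {k} := fun k =>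
    hY.measureReal_eq (p := fun y => y = k) .of_discrete
  have hle : ∀ k, (poissonBinomialMeasure p).real {k} ≤ (√(1 + 2 * v))⁻¹ := fun k =>
    (poissonBinomialMeasure_singleton_le p k).trans (gaussAverage_le_inv_sqrt hv)
  rw [deltaInfty]
  simp_rw [hpre]
  set s := ⨆ k : ℤ, (poissonBinomialMeasure p).real {k}
  have hsle : s ≤ (√(1 + 2 * v))⁻¹ := ciSup_le hle
  -- Positivity is needed to invert `s ^ 2 ≤ (1 + 2 * v)⁻¹`; some atom is charged since the law is
  -- nonzero on a countable space.
  have hspos : 0 < s := by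
    obtain ⟨k, hk⟩ : ∃ k : ℤ, poissonBinomialMeasure p {k} ≠ 0 := by
      by_contra! hzero
      have := (Measure.ext_iff_singleton (μ := poissonBinomialMeasure p) (ν := 0)).2
        fun k => by simpa using hzero k
      exact IsProbabilityMeasure.ne_zero _ this
    refine lt_of_lt_of_le ?_ (le_ciSup ⟨_, Set.forall_mem_range.2 hle⟩ k)
    exact ENNReal.toReal_pos hk (measure_ne_top _ _)
  have hs2 := pow_le_pow_left₀ hspos.le hsle 2
  rw [inv_pow, Real.sq_sqrt (by positivity)] at hs2
  have := inv_anti₀ (by positivity) hs2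
  rw [inv_inv] at this
  linarith

theorem mainTheorem3 {Ω : Type*} [MeasurableSpace Ω] (P : Measure Ω) [IsProbabilityMeasure P]
    (Y : Ω → ℤ) (hY : IsPoissonBinomial Y P)
    (σ : ℝ) (hσ : Var[fun ω => (Y ω : ℝ); P] = σ ^ 2) :
    (∀ α α' : ℝ≥0∞, 2 ≤ α → α' = ENNReal.conjExponent α →
      ((Real.log (√(6 * σ ^ 2 * α'.toReal) /
          ∫ t in (0 : ℝ)..√(6 * σ ^ 2 * α'.toReal), Real.exp (-t ^ 2 / 2)) : ℝ) : EReal)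
        ≤ renyiEntropy α Y P ∧
      (((1 / 2 : ℝ) * max (Real.log (1 + 2 * α'.toReal * σ ^ 2))
          (Real.log (12 * α'.toReal * σ ^ 2 / Real.pi)) : ℝ) : EReal)
        ≤ renyiEntropy α Y P) ∧
    2 * Var[fun ω => (Y ω : ℝ); P] ≤ deltaInfty Y P := by
  obtain ⟨n, p, hY⟩ := hY
  have hvar : Var[fun ω => (Y ω : ℝ); P] =
      Var[fun k : ℤ => (k : ℝ); poissonBinomialMeasure p] := by
    rw [← hY.map_eq, variance_map (by fun_prop) hY.aemeasurable]
    rfl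
  refine ⟨?_, hvar ▸ two_mul_variance_le_deltaInfty hY⟩
  rintro α α' hα rfl
  have h := renyiEntropy_ge hY hα
  rw [← hvar, hσ] at h
  set c := (ENNReal.conjExponent α).toReal
  have hl : 0 ≤ c * σ ^ 2 := mul_nonneg ENNReal.toReal_nonneg (sq_nonneg σ)
  rw [show 6 * σ ^ 2 * c = 6 * (c * σ ^ 2) by ring, mul_assoc 2, mul_assoc 12,
    log_sqrt_div_integral hl]
  exact ⟨h, (EReal.coe_le_coe_iff.2 (half_max_log_le hl)).trans h⟩
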